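/- Let $(N,\xi)$ be a closed connected co-oriented contact manifold, and let $G=\mathrm{Cont}_0(N,\xi)$ be the group of contactomorphisms (diffeomorphisms preserving $\xi$ and its co-orientation) that are smoothly isotopic to the identity through contactomorphisms. For a global contact form $\alpha$ (with $\ker\alpha=\xi$, compatible with the co-orientation) and $\psi\in G$ put \[ |\psi|_\alpha=\inf\int_0^1 \max_N|H_t|\,dt, \] where the infimum runs over all smooth isotopies $\{\psi_t\}_{t\in[0,1]}$ of contactomorphisms with $\psi_0=1$ and $\psi_1=\psi$, and $H_t=\alpha(Y_t)$ is the contact Hamiltonian of the isotopy, $Y_t=\frac{d}{dt'}\big|_{t'=t}\psi_{t'}\circ\psi_t^{-1}$. Let $d_\alpha(\phi,\psi)=|\psi\phi^{-1}|_\alpha$ for $\phi,\psi\in G$. **Lemma.** Let $\alpha,\alpha'$ be two contact forms for $(N,\xi)$ compatible with the co-orientation. If $f\in C^\infty(N,\mathbb{R}_{>0})$ is the function with $\alpha'=f\cdot\alpha$, then for all $\phi,\psi\in G$ \[ \min_N(f)\cdot d_\alpha(\phi,\psi)\;\le\; d_{\alpha'}(\phi,\psi)\;\le\;\max_N(f)\cdot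 d_\alpha(\phi,\psi). \] Consequently, for any two such contact forms $\alpha,\alpha'$, the metrics $d_\alpha$ and $d_{\alpha'}$ on $G$ are equivalent: each is bounded by a positive constant multiple of the other, and they define the same topology on $G$. -/

import Mathlib

open Set Bundle
open scoped Manifold ContDiff Topology

noncomputable section

namespace ContactHofer

/-- The model space of manifolds of dimension `2 n + 1`. -/
abbrev Model (n : ℕ) : Type := EuclideanSpace ℝ (Fin (2 * n + 1))

section OneForms

variable {n : ℕ} {N : Type*} [TopologicalSpace N] [ChartedSpace (Model n) N]

/-- The representative of the `1`-form `α` in the preferred chart `φ` at `x`, that is the `1`-form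
`(φ⁻¹)^* α` on (the target of the chart in) the model vector space. -/
def chartRep (α : ∀ x : N, TangentSpace 𝓘(ℝ, Model n) x →L[ℝ] ℝ) (x : N) :
    Model n → (Model n →L[ℝ] ℝ) := fun y =>
  (α ((extChartAt 𝓘(ℝ, Model n) x).symm y)).comp
    (mfderiv 𝓘(ℝ, Model n) 𝓘(ℝ, Model n) (extChartAt 𝓘(ℝ, Model n) x).symm y)

/-- The exterior derivative `(dα)_x (u, v)` of a `1`-form, computed in the preferred chart at `x`
by `dω (u, v) = (D_u ω) v - (D_v ω) u`. -/
def extDerivAt (α : ∀ x : N, TangentSpace 𝓘(ℝ, Model n) x →L[ℝ] ℝ) (x : N)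
    (u v : TangentSpace 𝓘(ℝ, Model n) x) : ℝ :=
  let φ := extChartAt 𝓘(ℝ, Model n) x
  let D : Model n →L[ℝ] Model n := mfderiv 𝓘(ℝ, Model n) 𝓘(ℝ, Model n) φ x
  fderiv ℝ (chartRep α x) (φ x) (D u) (D v) - fderiv ℝ (chartRep α x) (φ x) (D v) (D u)

variable [IsManifold 𝓘(ℝ, Model n) ∞ N]

/-- A `1`-form `α` is a contact form if it is smooth, nowhere zero, and `dα` is nondegenerate on
the hyperplane field `ker α` (in other words `α ∧ (dα)^n` vanishes nowhere). -/
structure IsContactForm (α : ∀ x : N, TangentSpace 𝓘(ℝ, Model n) x →L[ℝ] ℝ) : Prop where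
  smooth : ContMDiff 𝓘(ℝ, Model n) (𝓘(ℝ, Model n).prod 𝓘(ℝ, Model n →L[ℝ] ℝ)) ∞
    (fun x : N => TotalSpace.mk' (Model n →L[ℝ] ℝ)
      (E := fun x : N => TangentSpace 𝓘(ℝ, Model n) x →L[ℝ] ℝ) x (α x))
  ne_zero : ∀ x, α x ≠ 0
  nondegenerate : ∀ (x : N) (u : TangentSpace 𝓘(ℝ, Model n) x), α x u = 0 →
    (∀ v : TangentSpace 𝓘(ℝ, Model n) x, α x v = 0 → extDerivAt α x u v = 0) → u = 0

end OneForms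

section ContactManifold

variable (n : ℕ) (N : Type*) [TopologicalSpace N] [ChartedSpace (Model n) N]
  [IsManifold 𝓘(ℝ, Model n) ∞ N]

/-- A co-oriented contact structure on `N`: a hyperplane field `ξ` together with a choice `pos x`
of one of the two components of the complement of `ξ x`, which can be defined by a global contact
form `α` as `ξ = ker α`, `pos = {α > 0}`. -/
structure ContactStructure where
  ξ : ∀ x : N, Submodule ℝ (TangentSpace 𝓘(ℝ, Model n) x)
  pos : ∀ x : N, Set (TangentSpace 𝓘(ℝ, Model n) x)
  exists_form : ∃ α : ∀ x : N, TangentSpace 𝓘(ℝ, Model n) x →L[ℝ] ℝ, IsContactForm α ∧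
    (∀ x v, v ∈ ξ x ↔ α x v = 0) ∧ (∀ x v, v ∈ pos x ↔ 0 < α x v)

/-- The diffeomorphisms of `N`. -/
abbrev Diff : Type _ := Diffeomorph 𝓘(ℝ, Model n) 𝓘(ℝ, Model n) N N ∞

/-- Diffeomorphisms form a group under composition: `(φ * ψ) x = φ (ψ x)`. -/
instance instGroupDiff : Group (Diff n N) where
  mul φ ψ := ψ.trans φ
  one := Diffeomorph.refl _ N ∞
  inv φ := φ.symm
  mul_assoc _ _ _ := Diffeomorph.ext fun _ => rfl
  one_mul _ := Diffeomorph.ext fun _ => rfl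
  mul_one _ := Diffeomorph.ext fun _ => rfl
  inv_mul_cancel φ := Diffeomorph.ext fun x => φ.symm_apply_apply x

variable {n N}

namespace ContactStructure

variable (C : ContactStructure n N)

/-- `α` is a contact form for `(N, ξ)` compatible with the co-orientation. -/
structure IsCompatible (α : ∀ x : N, TangentSpace 𝓘(ℝ, Model n) x →L[ℝ] ℝ) : Prop where
  isContactForm : IsContactForm α
  mem_ξ_iff : ∀ x v, v ∈ C.ξ x ↔ α x v = 0
  mem_pos_iff : ∀ x v, v ∈ C.pos x ↔ 0 < α x v

/-- A diffeomorphism with `ψ_* ξ = ξ` that preserves the co-orientation. -/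
structure IsContactomorphism (ψ : Diff n N) : Prop where
  map_ξ : ∀ x v, mfderiv 𝓘(ℝ, Model n) 𝓘(ℝ, Model n) ψ x v ∈ C.ξ (ψ x) ↔ v ∈ C.ξ x
  map_pos : ∀ x v, mfderiv 𝓘(ℝ, Model n) 𝓘(ℝ, Model n) ψ x v ∈ C.pos (ψ x) ↔ v ∈ C.pos x

/-- A smooth isotopy `{ψ_t}`, `t ∈ [0, 1]`, of contactomorphisms with `ψ_0 = 1`. Only the values at
times in `[0, 1]` are relevant. -/
structure Isotopy where
  map : ℝ → Diff n N
  smooth : ContMDiffOn (𝓘(ℝ, ℝ).prod 𝓘(ℝ, Model n)) 𝓘(ℝ, Model n) ∞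
    (fun p : ℝ × N => map p.1 p.2) (Icc 0 1 ×ˢ univ)
  map_zero : map 0 = 1
  isContactomorphism : ∀ t ∈ Icc (0 : ℝ) 1, C.IsContactomorphism (map t)

namespace Isotopy

variable {C}

/-- The velocity `d/ds|_{s = t} ψ_s (x)`, a tangent vector at `ψ_t (x)`; at `t = 0, 1` it is
the one-sided derivative. -/
def velocity (γ : C.Isotopy) (t : ℝ) (x : N) : TangentSpace 𝓘(ℝ, Model n) (γ.map t x) :=
  mfderivWithin 𝓘(ℝ, ℝ) 𝓘(ℝ, Model n) (fun s : ℝ => γ.map s x) (Icc 0 1) t (1 : ℝ)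

/-- The contact Hamiltonian `H_t (y) = α (Y_t (y))`, where `Y_t (y)` is the velocity at time `t`
of the trajectory that starts at `x = ψ_t⁻¹ (y)`. -/
def hamiltonian (α : ∀ x : N, TangentSpace 𝓘(ℝ, Model n) x →L[ℝ] ℝ) (γ : C.Isotopy)
    (t : ℝ) (y : N) : ℝ :=
  α (γ.map t ((γ.map t)⁻¹ y)) (γ.velocity t ((γ.map t)⁻¹ y))

/-- The energy `∫_0^1 max_N |H_t| dt` of an isotopy. -/
def energy (α : ∀ x : N, TangentSpace 𝓘(ℝ, Model n) x →L[ℝ] ℝ) (γ : C.Isotopy) : ℝ :=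
  ∫ t in (0 : ℝ)..1, ⨆ y : N, |γ.hamiltonian α t y|

end Isotopy

theorem IsContactomorphism.one : C.IsContactomorphism 1 where
  map_ξ x v := by
    rw [show ⇑(1 : Diff n N) = id from rfl, mfderiv_id]
    exact Iff.rfl
  map_pos x v := by
    rw [show ⇑(1 : Diff n N) = id from rfl, mfderiv_id]
    exact Iff.rfl

theorem IsContactomorphism.mul {φ ψ : Diff n N} (hφ : C.IsContactomorphism φ)
    (hψ : C.IsContactomorphism ψ) : C.IsContactomorphism (φ * ψ) := by
  have key : ∀ x, mfderiv 𝓘(ℝ, Model n) 𝓘(ℝ, Model n) (φ * ψ) x =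
      (mfderiv 𝓘(ℝ, Model n) 𝓘(ℝ, Model n) φ (ψ x)).comp
        (mfderiv 𝓘(ℝ, Model n) 𝓘(ℝ, Model n) ψ x) := fun x =>
    mfderiv_comp x (φ.mdifferentiable (by simp) _) (ψ.mdifferentiable (by simp) _)
  refine ⟨fun x v => ?_, fun x v => ?_⟩
  · rw [key]
    exact (hφ.map_ξ (ψ x) _).trans (hψ.map_ξ x v)
  · rw [key]
    exact (hφ.map_pos (ψ x) _).trans (hψ.map_pos x v)

theorem IsContactomorphism.inv {φ : Diff n N} (hφ : C.IsContactomorphism φ) :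
    C.IsContactomorphism φ⁻¹ := by
  have h1 : φ * φ⁻¹ = 1 := mul_inv_cancel φ
  have key : ∀ x, (mfderiv 𝓘(ℝ, Model n) 𝓘(ℝ, Model n) φ (φ⁻¹ x)).comp
      (mfderiv 𝓘(ℝ, Model n) 𝓘(ℝ, Model n) (φ⁻¹ : Diff n N) x) =
        mfderiv 𝓘(ℝ, Model n) 𝓘(ℝ, Model n) (φ * φ⁻¹) x := fun x =>
    (mfderiv_comp x (φ.mdifferentiable (by simp) _) (φ⁻¹.mdifferentiable (by simp) _)).symm
  have hone := IsContactomorphism.one C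
  rw [← h1] at hone
  refine ⟨fun x v => ?_, fun x v => ?_⟩
  · have h := hone.map_ξ x v
    rw [← key] at h
    exact (hφ.map_ξ (φ⁻¹ x) _).symm.trans h
  · have h := hone.map_pos x v
    rw [← key] at h
    exact (hφ.map_pos (φ⁻¹ x) _).symm.trans h

/-- The group `Cont_0 (N, ξ)` of contactomorphisms isotopic to the identity through
contactomorphisms. -/
def Cont₀ : Subgroup (Diff n N) where
  carrier := {ψ | ∃ γ : C.Isotopy, γ.map 1 = ψ}
  mul_mem' := by
    rintro _ _ ⟨γ, rfl⟩ ⟨δ, rfl⟩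
    refine ⟨⟨fun t => γ.map t * δ.map t, ?_, ?_, ?_⟩, rfl⟩
    · refine γ.smooth.comp (f := fun p : ℝ × N => (p.1, δ.map p.1 p.2))
        (contMDiffOn_fst.prodMk δ.smooth) ?_
      rintro ⟨t, x⟩ ⟨ht, -⟩
      exact ⟨ht, mem_univ _⟩
    · simp [γ.map_zero, δ.map_zero]
    · exact fun t ht => .mul C (γ.isContactomorphism t ht) (δ.isContactomorphism t ht)
  one_mem' := ⟨⟨fun _ => 1, contMDiffOn_snd, rfl, fun _ _ => .one C⟩, rfl⟩
  inv_mem' := by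
    rintro _ ⟨γ, rfl⟩
    refine ⟨⟨fun t => γ.map (1 - t) * (γ.map 1)⁻¹, ?_, ?_, ?_⟩, ?_⟩
    · refine γ.smooth.comp (f := fun p : ℝ × N => (1 - p.1, (γ.map 1)⁻¹ p.2))
        (ContMDiffOn.prodMk ?_ ?_) ?_
      · have h : ContMDiff 𝓘(ℝ, ℝ) 𝓘(ℝ, ℝ) ∞ (fun t : ℝ => 1 - t) :=
          (contDiff_const.sub contDiff_id).contMDiff
        exact (h.comp contMDiff_fst).contMDiffOn
      · exact ((γ.map 1).symm.contMDiff.comp contMDiff_snd).contMDiffOn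
      · rintro ⟨t, x⟩ ⟨ht, -⟩
        exact ⟨⟨by linarith [ht.2], by linarith [ht.1]⟩, mem_univ _⟩
    · simp
    · exact fun t ht => .mul C (γ.isContactomorphism _ ⟨by linarith [ht.2], by linarith [ht.1]⟩)
        (.inv C (γ.isContactomorphism 1 (by simp)))
    · simp [γ.map_zero]

/-- The Hofer energy `|ψ|_α`: the infimum of the energies of the isotopies that end at `ψ`. -/
def hoferNorm (α : ∀ x : N, TangentSpace 𝓘(ℝ, Model n) x →L[ℝ] ℝ) (ψ : C.Cont₀) : ℝ :=
  sInf {e | ∃ γ : C.Isotopy, γ.map 1 = ψ ∧ e = γ.energy α}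

/-- The contact Hofer distance `d_α (φ, ψ) = |ψ φ⁻¹|_α` on `Cont_0 (N, ξ)`. -/
def hoferDist (α : ∀ x : N, TangentSpace 𝓘(ℝ, Model n) x →L[ℝ] ℝ) (φ ψ : C.Cont₀) : ℝ :=
  C.hoferNorm α (ψ * φ⁻¹)

end ContactStructure

end ContactManifold

section Metrics

variable {G : Type*}

/-- The topology of a distance function: a set is open if around each of its points it contains
a ball of positive radius. -/
abbrev distTopology (d : G → G → ℝ) : TopologicalSpace G where
  IsOpen U := ∀ x ∈ U, ∃ ε > 0, ∀ y, d x y < ε → y ∈ U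
  isOpen_univ _ _ := ⟨1, one_pos, fun _ _ => mem_univ _⟩
  isOpen_inter U V hU hV x hx := by
    obtain ⟨ε, hε, h⟩ := hU x hx.1
    obtain ⟨δ, hδ, k⟩ := hV x hx.2
    exact ⟨min ε δ, lt_min hε hδ, fun y hy =>
      ⟨h y (hy.trans_le (min_le_left _ _)), k y (hy.trans_le (min_le_right _ _))⟩⟩
  isOpen_sUnion S hS x hx := by
    obtain ⟨U, hU, hxU⟩ := hx
    obtain ⟨ε, hε, h⟩ := hS U hU x hxU
    exact ⟨ε, hε, fun y hy => ⟨U, hU, h y hy⟩⟩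

/-- Equivalence of metrics: each is bounded by a positive constant multiple of the other. -/
def EquivalentDist (d d' : G → G → ℝ) : Prop :=
  ∃ c > 0, ∃ C > 0, ∀ x y, c * d x y ≤ d' x y ∧ d' x y ≤ C * d x y

end Metrics

end ContactHofer

end

namespace ContactHofer

/-! For a fixed isotopy the two Hamiltonians satisfy `H'_t = (f ∘ ψ_t)(x) H_t` at `y = ψ_t x`, that
is `H'_t = f H_t`, so a pointwise bound `|α'| ≤ M |α|` passes to the maximum over `N`, to the time
integral, and to the infimum over the same isotopies (`energy_le_mul`, `hoferNorm_le_mul`). The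
lower bound is this upper bound with the two forms exchanged. The analytic point is integrability of
`t ↦ max |H_t|`: the form evaluated on the velocity is jointly continuous on `[0, 1] × N`, and `N`
is compact. Co-orientation makes the ratio `f` positive; compactness makes it attain its extrema. -/

theorem exists_eq_pos_smul {V : Type*} [AddCommGroup V] [Module ℝ V] [TopologicalSpace V]
    {a b : V →L[ℝ] ℝ} (ha : a ≠ 0) (hker : ∀ v, a v = 0 ↔ b v = 0)
    (hpos : ∀ v, 0 < a v ↔ 0 < b v) : ∃ c : ℝ, 0 < c ∧ b = c • a := by
  obtain ⟨v, hv⟩ : ∃ v, 0 < a v := by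
    obtain ⟨v, hv⟩ : ∃ v, a v ≠ 0 := by
      by_contra! h
      exact ha (ContinuousLinearMap.ext h)
    rcases hv.lt_or_gt with h | h
    · exact ⟨-v, by simpa using h⟩
    · exact ⟨v, h⟩
  refine ⟨b v / a v, div_pos ((hpos v).1 hv) hv, ContinuousLinearMap.ext fun w => ?_⟩
  -- Subtracting a multiple of `v` projects `w` to the common kernel.
  have h : b (w - (a w / a v) • v) = 0 := (hker _).1 (by simp [hv.ne'])
  simp only [map_sub, map_smul, smul_eq_mul, sub_eq_zero] at h
  simp only [smul_apply, smul_eq_mul, h]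
  ring

section Manifold

variable {n : ℕ} {N : Type*} [TopologicalSpace N] [ChartedSpace (Model n) N]
  [IsManifold 𝓘(ℝ, Model n) ∞ N]

/-- The ratio of a continuous `1`-form to a continuous nowhere zero `1`-form is continuous. -/
theorem continuous_of_eq_smul {α α' : ∀ x : N, TangentSpace 𝓘(ℝ, Model n) x →L[ℝ] ℝ}
    (hα : IsContactForm α) (hα' : IsContactForm α') {f : N → ℝ} (hf : ∀ x, α' x = f x • α x) :
    Continuous f := by
  refine continuous_iff_continuousAt.2 fun x₀ => ?_
  obtain ⟨v, hv⟩ : ∃ v, α x₀ v ≠ 0 := by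
    by_contra! h
    exact hα.ne_zero x₀ (ContinuousLinearMap.ext h)
  -- Near `x₀`, `f` is the quotient of the two forms evaluated on a local vector field extending
  -- `v`.
  have key : ∀ {β : ∀ x : N, TangentSpace 𝓘(ℝ, Model n) x →L[ℝ] ℝ}, IsContactForm β →
      ContinuousAt (fun x => β x (FiberBundle.extend (Model n) v x)) x₀ := by
    intro β hβ
    have h := (hβ.smooth x₀).clm_bundle_apply (F₂ := ℝ) (E₂ := fun _ : N => ℝ)
      (FiberBundle.contMDiffAt_extend 𝓘(ℝ, Model n) (Model n) v)
    exact ((Bundle.contMDiffAt_section x₀).1 h).continuousAt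
  have h0 : α x₀ (FiberBundle.extend (Model n) v x₀) ≠ 0 := by simpa using hv
  refine ((key hα').div (key hα) h0).congr ?_
  filter_upwards [(key hα).eventually_ne h0] with x hx
  simp [hf x, hx]

variable {C : ContactStructure n N}

namespace ContactStructure

/-! ### Regularity and energy of isotopies -/

namespace Isotopy

/-- The velocity is the time derivative of a family with parameter `p = (t, x)`, taken at time `p.1`
and applied to the vector `1`; `p.1` serves both as parameter and as evaluation time. Unique
differentiability of `Icc 0 1` covers the endpoints. -/
theorem contMDiffOn_velocity (γ : C.Isotopy) :
    ContMDiffOn (𝓘(ℝ, ℝ).prod 𝓘(ℝ, Model n)) 𝓘(ℝ, Model n).tangent 0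
      (fun p : ℝ × N => TotalSpace.mk' (Model n) (E := TangentSpace 𝓘(ℝ, Model n))
        (γ.map p.1 p.2) (γ.velocity p.1 p.2)) (Icc 0 1 ×ˢ univ) := by
  intro p₀ hp₀
  have hu : UniqueMDiffOn 𝓘(ℝ, ℝ) (Icc (0 : ℝ) 1) :=
    (uniqueDiffOn_Icc zero_lt_one).uniqueMDiffOn
  have h := ContMDiffWithinAt.mfderivWithin (I := 𝓘(ℝ, ℝ)) (I' := 𝓘(ℝ, Model n))
    (J := 𝓘(ℝ, ℝ).prod 𝓘(ℝ, Model n)) (m := 0) (n := ∞)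
    (f := fun (p : ℝ × N) (s : ℝ) => γ.map s p.2) (g := fun p : ℝ × N => p.1) (N := ℝ × N)
    (M := ℝ) (M' := N)
    (t := Icc (0 : ℝ) 1 ×ˢ univ) (u := Icc 0 1) (x₀ := p₀) ?_
    (contMDiffWithinAt_fst (I := 𝓘(ℝ, ℝ)) (J := 𝓘(ℝ, Model n)) (M := ℝ) (N := N)) hp₀
    (fun p hp => hp.1) (by simp) hu
  · refine ContMDiffWithinAt.clm_apply_of_inCoordinates (IB₁ := 𝓘(ℝ, ℝ))
      (IB₂ := 𝓘(ℝ, Model n)) (b₁ := fun p : ℝ × N => p.1)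
      (b₂ := fun p : ℝ × N => γ.map p.1 p.2) (F₁ := ℝ) (F₂ := Model n)
      (E₁ := TangentSpace 𝓘(ℝ, ℝ)) (E₂ := TangentSpace 𝓘(ℝ, Model n))
      (v := fun _ => (1 : ℝ)) h ?_
      ((γ.smooth p₀ hp₀).of_le (by simp))
    have hone : ContMDiff 𝓘(ℝ, ℝ) 𝓘(ℝ, ℝ).tangent 0
        (fun t : ℝ => TotalSpace.mk' ℝ (E := TangentSpace 𝓘(ℝ, ℝ)) t (1 : ℝ)) :=
      contMDiff_vectorSpace_iff_contDiff.2 contDiff_const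
    exact hone.contMDiffAt.comp_contMDiffWithinAt p₀ contMDiffWithinAt_fst
  · refine ContMDiffWithinAt.comp (f := fun q : (ℝ × N) × ℝ => (q.2, q.1.2)) (p₀, p₀.1)
      (γ.smooth (p₀.1, p₀.2) hp₀) ?_ ?_
    · exact contMDiffWithinAt_snd.prodMk (contMDiffWithinAt_snd.comp _ contMDiffWithinAt_fst
        (mapsTo_univ _ _))
    · exact fun q hq => ⟨hq.2, mem_univ _⟩

theorem continuousOn_form_velocity {α : ∀ x : N, TangentSpace 𝓘(ℝ, Model n) x →L[ℝ] ℝ}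
    (hα : IsContactForm α) (γ : C.Isotopy) :
    ContinuousOn (fun p : ℝ × N => α (γ.map p.1 p.2) (γ.velocity p.1 p.2))
      (Icc 0 1 ×ˢ univ) := by
  intro p hp
  have h := ContMDiffWithinAt.clm_bundle_apply (F₂ := ℝ) (E₂ := fun _ : N => ℝ)
    ((hα.smooth.of_le zero_le).contMDiffAt.comp_contMDiffWithinAt p
      ((γ.smooth p hp).of_le zero_le)) (γ.contMDiffOn_velocity p hp)
  exact (contMDiffWithinAt_totalSpace.1 h).2.continuousWithinAt

/-- The substitution `y = ψ_t x` removes `ψ_t⁻¹`, whose regularity in `t` is then never needed. -/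
theorem iSup_abs_hamiltonian (α : ∀ x : N, TangentSpace 𝓘(ℝ, Model n) x →L[ℝ] ℝ)
    (γ : C.Isotopy) (t : ℝ) :
    ⨆ y, |γ.hamiltonian α t y| = ⨆ x, |α (γ.map t x) (γ.velocity t x)| :=
  Function.Surjective.iSup_comp (γ.map t)⁻¹.surjective
    fun x => |α (γ.map t x) (γ.velocity t x)|

theorem energy_nonneg (α : ∀ x : N, TangentSpace 𝓘(ℝ, Model n) x →L[ℝ] ℝ) (γ : C.Isotopy) :
    0 ≤ γ.energy α :=
  intervalIntegral.integral_nonneg zero_le_one fun _ _ => Real.iSup_nonneg fun _ => abs_nonneg _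

section Compact

variable [CompactSpace N] {α α' : ∀ x : N, TangentSpace 𝓘(ℝ, Model n) x →L[ℝ] ℝ}

theorem continuousOn_iSup_abs_hamiltonian (hα : IsContactForm α) (γ : C.Isotopy) :
    ContinuousOn (fun t => ⨆ y, |γ.hamiltonian α t y|) (Icc 0 1) := by
  simp only [iSup_abs_hamiltonian]
  rw [continuousOn_iff_continuous_domRestrict]
  have h : Continuous fun p : Icc (0 : ℝ) 1 × N =>
      |α (γ.map p.1 p.2) (γ.velocity p.1 p.2)| :=
    ((γ.continuousOn_form_velocity hα).comp_continuous (f := fun p : Icc (0 : ℝ) 1 × N =>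
      ((p.1 : ℝ), p.2)) (by fun_prop) fun p => ⟨p.1.2, mem_univ _⟩).abs
  have h' := isCompact_univ.continuous_sSup
    (f := fun (t : Icc (0 : ℝ) 1) x => |α (γ.map t x) (γ.velocity t x)|) h
  simp only [image_univ] at h'
  exact h'

theorem bddAbove_abs_form_velocity (hα : IsContactForm α) (γ : C.Isotopy) {t : ℝ}
    (ht : t ∈ Icc (0 : ℝ) 1) :
    BddAbove (range fun x => |α (γ.map t x) (γ.velocity t x)|) :=
  (isCompact_range ((γ.continuousOn_form_velocity hα).comp_continuous
    (f := fun x : N => (t, x)) (by fun_prop) fun _ => ⟨ht, mem_univ _⟩).abs).bddAbove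

theorem energy_le_mul (hα : IsContactForm α) (hα' : IsContactForm α') {M : ℝ} (hM : 0 ≤ M)
    (h : ∀ x v, |α' x v| ≤ M * |α x v|) (γ : C.Isotopy) : γ.energy α' ≤ M * γ.energy α := by
  have hint : ∀ {β : ∀ x : N, TangentSpace 𝓘(ℝ, Model n) x →L[ℝ] ℝ}, IsContactForm β →
      IntervalIntegrable (fun t => ⨆ y, |γ.hamiltonian β t y|) MeasureTheory.volume 0 1 :=
    fun hβ => (γ.continuousOn_iSup_abs_hamiltonian hβ).intervalIntegrable_of_Icc zero_le_one
  rw [energy, energy, ← intervalIntegral.integral_const_mul]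
  refine intervalIntegral.integral_mono_on zero_le_one (hint hα') ((hint hα).const_mul M)
    fun t ht => ?_
  rw [iSup_abs_hamiltonian, iSup_abs_hamiltonian]
  -- Nonnegativity of the bound covers empty `N`, where the supremum is `0`.
  refine Real.iSup_le (fun x => (h _ _).trans ?_)
    (mul_nonneg hM (Real.iSup_nonneg fun _ => abs_nonneg _))
  exact mul_le_mul_of_nonneg_left (le_ciSup (γ.bddAbove_abs_form_velocity hα ht) x) hM

end Compact

end Isotopy

section Compact

variable [CompactSpace N] {α α' : ∀ x : N, TangentSpace 𝓘(ℝ, Model n) x →L[ℝ] ℝ}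

theorem hoferNorm_le_mul (hα : IsContactForm α) (hα' : IsContactForm α') {M : ℝ} (hM : 0 ≤ M)
    (h : ∀ x v, |α' x v| ≤ M * |α x v|) (ψ : C.Cont₀) :
    C.hoferNorm α' ψ ≤ M * C.hoferNorm α ψ := by
  -- Membership in `Cont₀` makes the set of energies nonempty, so `sInf` is a genuine infimum and
  -- not the default `0`.
  obtain ⟨γ₀, hγ₀⟩ := ψ.2
  have hne : {e | ∃ γ : C.Isotopy, γ.map 1 = ψ ∧ e = γ.energy α}.Nonempty := ⟨_, γ₀, hγ₀, rfl⟩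
  rw [hoferNorm, hoferNorm, ← smul_eq_mul, ← Real.sInf_smul_of_nonneg hM]
  refine le_csInf hne.smul_set ?_
  rintro _ ⟨_, ⟨γ, hγ, rfl⟩, rfl⟩
  have hbdd : BddBelow {e | ∃ γ : C.Isotopy, γ.map 1 = ψ ∧ e = γ.energy α'} := by
    refine ⟨0, ?_⟩
    rintro _ ⟨δ, -, rfl⟩
    exact δ.energy_nonneg α'
  exact (csInf_le hbdd ⟨γ, hγ, rfl⟩).trans (γ.energy_le_mul hα hα' hM h)

/-- The comparison of the Hofer distances of two contact forms with bounded ratio. -/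
theorem hoferDist_bounds (hα : IsContactForm α) (hα' : IsContactForm α') {f : N → ℝ}
    (hf : ∀ x, α' x = f x • α x) {m M : ℝ} (hm : 0 < m) (hmf : ∀ x, m ≤ f x)
    (hfM : ∀ x, f x ≤ M) (hM : 0 ≤ M) (φ ψ : C.Cont₀) :
    m * C.hoferDist α φ ψ ≤ C.hoferDist α' φ ψ ∧
      C.hoferDist α' φ ψ ≤ M * C.hoferDist α φ ψ := by
  have habs : ∀ x v, |α' x v| = f x * |α x v| := fun x v => by
    rw [hf, smul_apply, smul_eq_mul, abs_mul, abs_of_pos (hm.trans_le (hmf x))]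
  constructor
  -- Exchange the forms: `|α| ≤ m⁻¹ |α'|`.
  · rw [← le_inv_mul_iff₀ hm]
    refine hoferNorm_le_mul hα' hα (inv_nonneg.2 hm.le) (fun x v => ?_) _
    rw [le_inv_mul_iff₀ hm, habs]
    exact mul_le_mul_of_nonneg_right (hmf x) (abs_nonneg _)
  · refine hoferNorm_le_mul hα hα' hM (fun x v => ?_) _
    rw [habs]
    exact mul_le_mul_of_nonneg_right (hfM x) (abs_nonneg _)

/-- The comparison of the Hofer distances of two contact forms by the extrema of their ratio. -/
theorem exists_extrema_hoferDist_bounds [Nonempty N] (hα : IsContactForm α)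
    (hα' : IsContactForm α') {f : N → ℝ} (hpos : ∀ x, 0 < f x) (hf : ∀ x, α' x = f x • α x) :
    ∃ m M : ℝ, IsLeast (range f) m ∧ IsGreatest (range f) M ∧
      ∀ φ ψ : C.Cont₀, m * C.hoferDist α φ ψ ≤ C.hoferDist α' φ ψ ∧
        C.hoferDist α' φ ψ ≤ M * C.hoferDist α φ ψ := by
  have hK : IsCompact (range f) := isCompact_range (continuous_of_eq_smul hα hα' hf)
  obtain ⟨m, hm⟩ := hK.exists_isLeast (range_nonempty f)
  obtain ⟨M, hM⟩ := hK.exists_isGreatest (range_nonempty f)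
  have hm0 : 0 < m := by
    obtain ⟨x, rfl⟩ := hm.1
    exact hpos x
  exact ⟨m, M, hm, hM, hoferDist_bounds hα hα' hf hm0 (fun x => hm.2 ⟨x, rfl⟩)
    (fun x => hM.2 ⟨x, rfl⟩) (hm0.le.trans (hm.2 hM.1))⟩

end Compact

theorem IsCompatible.exists_eq_smul {α α' : ∀ x : N, TangentSpace 𝓘(ℝ, Model n) x →L[ℝ] ℝ}
    (hα : C.IsCompatible α) (hα' : C.IsCompatible α') :
    ∃ f : N → ℝ, (∀ x, 0 < f x) ∧ ∀ x, α' x = f x • α x := by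
  choose f hpos hf using fun x => exists_eq_pos_smul (hα.isContactForm.ne_zero x)
    (fun v => (hα.mem_ξ_iff x v).symm.trans (hα'.mem_ξ_iff x v))
    (fun v => (hα.mem_pos_iff x v).symm.trans (hα'.mem_pos_iff x v))
  exact ⟨f, hpos, hf⟩

end ContactStructure

end Manifold

section Metrics

variable {G : Type*} {d d' : G → G → ℝ}

/-- The `d'`-ball of radius `ε / K` lies in the `d`-ball of radius `ε`; no metric axiom is involved.
-/
theorem distTopology_le_of_le_mul {K : ℝ} (hK : 0 < K) (h : ∀ x y, d x y ≤ K * d' x y) :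
    distTopology d' ≤ distTopology d := by
  intro U hU x hx
  obtain ⟨ε, hε, hball⟩ := hU x hx
  refine ⟨ε / K, div_pos hε hK, fun y hy => hball y ((h x y).trans_lt ?_)⟩
  rwa [lt_div_iff₀' hK] at hy

theorem EquivalentDist.distTopology_eq (h : EquivalentDist d d') :
    distTopology d = distTopology d' := by
  obtain ⟨c, hc, K, hK, h⟩ := h
  exact le_antisymm (distTopology_le_of_le_mul hK fun x y => (h x y).2)
    (distTopology_le_of_le_mul (inv_pos.2 hc) fun x y => (le_inv_mul_iff₀ hc).2 (h x y).1)

end Metrics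

end ContactHofer

theorem mainTheorem11 {n : ℕ} {N : Type*} [TopologicalSpace N] [T2Space N] [CompactSpace N]
    [ConnectedSpace N] [ChartedSpace (ContactHofer.Model n) N]
    [IsManifold 𝓘(ℝ, ContactHofer.Model n) ∞ N]
    (C : ContactHofer.ContactStructure n N)
    (α α' : ∀ x : N, TangentSpace 𝓘(ℝ, ContactHofer.Model n) x →L[ℝ] ℝ)
    (hα : C.IsCompatible α) (hα' : C.IsCompatible α') :
    (∀ f : N → ℝ, ContMDiff 𝓘(ℝ, ContactHofer.Model n) 𝓘(ℝ, ℝ) ∞ f → (∀ x, 0 < f x) →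
      (∀ x, α' x = f x • α x) →
      ∃ m M : ℝ, IsLeast (Set.range f) m ∧ IsGreatest (Set.range f) M ∧
        ∀ φ ψ : C.Cont₀, m * C.hoferDist α φ ψ ≤ C.hoferDist α' φ ψ ∧
          C.hoferDist α' φ ψ ≤ M * C.hoferDist α φ ψ) ∧
    ContactHofer.EquivalentDist (C.hoferDist α) (C.hoferDist α') ∧
    ContactHofer.distTopology (C.hoferDist α) = ContactHofer.distTopology (C.hoferDist α') := by
  have hequiv : ContactHofer.EquivalentDist (C.hoferDist α) (C.hoferDist α') := by
    obtain ⟨f, hpos, hf⟩ := hα.exists_eq_smul hα'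
    -- The extrema are values `f x` and `f y`, hence positive constants.
    obtain ⟨_, _, ⟨⟨x, rfl⟩, -⟩, ⟨⟨y, rfl⟩, -⟩, h⟩ :=
      ContactHofer.ContactStructure.exists_extrema_hoferDist_bounds (C := C)
        hα.isContactForm hα'.isContactForm hpos hf
    exact ⟨f x, hpos x, f y, hpos y, h⟩
  exact ⟨fun _ _ hpos hf => ContactHofer.ContactStructure.exists_extrema_hoferDist_bounds
    hα.isContactForm hα'.isContactForm hpos hf, hequiv, hequiv.distTopology_eq⟩
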